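/- A comparator $[i:j]$ puts the minimum of the contents of registers $i,j$ into register $i$ and the maximum into register $j$. A stage is a set of comparators connecting disjoint pairs of registers, a comparator network is a sequence of stages $S_1,\dots,S_d$ on a finite set of registers, and its running time is its number of stages $d$. The network is $p$-periodic if $p<d$ and $S_i=S_{i+p}$ for $1\le i\le d-p$. A pass of a network is one run through all of its stages. The delay of a network is the maximum, over all registers $r$ that occur in some stage, of $\mathrm{lst}(r)-\mathrm{fst}(r)+1$, where $\mathrm{fst}(r)$ and $\mathrm{lst}(r)$ are the indices of the first and the last stage in which $r$ occurs. The compact form of a network $S_1,\dots,S_d$ of delay $D$ consists of the $D$ stages $T_q=\bigcup\{S_{q+pD}: 0\le p\le (d-q)/D\}$, $1\le q\le D$. For $k\ge 3$ let $n=2^{k-1}-1$, $b=2(k-2)$ and $N_k=nb=(2^k-2)(k-2)$. Let $P_k$ be the network on the registers $0,1,\dots,N_k+1$ with the stages $S_{k,1}\cup\{[0:1],[N_k:N_k+1]\},\,S_{k,2},\dots,S_{k,2k-3}$, where $$S_{k,1}=\{[bi:bi+1]: 1\le i\le n-1\},$$ and, for $j=1,\dots,k-2$, $$S_{k,2j}=\{[bi+j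 : b(i+2^{k-j-1}-1)+(b-j+1)]: 0\le i\le n-2^{k-j-1}\},$$ $$S_{k,2j+1}=\{[bi+j:bi+j+1],\ [bi+(b-j):bi+(b-j+1)]: 0\le i\le n-1\}.$$ Let $M_k$ be the compact form of $P_k$ with the first and the last register (and the comparators touching them) deleted. Theorem. For every $k\ge 3$, $M_k$ is a comparator network with exactly three stages, on the $N_k=(2^k-2)(k-2)$ registers $1,\dots,N_k$, so that any $t\ge 2$ passes of $M_k$ form a $3$-periodic network. $M_k$ is a $(2k-5)$-pass merger: if the registers contain items of any linearly ordered set such that the sequence in the odd registers and the sequence in the even registers are both sorted, then after $2k-5$ passes of $M_k$ the registers $1,\dots,N_k$ contain the same items in sorted order. The running time, i.e. the number of stages in these $2k-5$ passes, is $6k-15\le 6\log_2 N_k$. -/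

import Mathlib

universe u

/-- A stage: a finite set of comparators. The comparator `[i:j]`, written as the pair `(i, j)`,
puts the minimum of the contents of registers `i` and `j` into register `i`, and the maximum
into register `j`. -/
abbrev Stage := Finset (ℕ × ℕ)

namespace Stage

/-- The registers that are touched by the comparators of a stage. -/
def regs (S : Stage) : Finset ℕ := S.image Prod.fst ∪ S.image Prod.snd

/-- The comparators of the stage connect disjoint pairs of (distinct) registers. -/
def IsValid (S : Stage) : Prop :=
  (∀ c ∈ S, c.1 ≠ c.2) ∧
    ∀ c ∈ S, ∀ c' ∈ S, c ≠ c' →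
      c.1 ≠ c'.1 ∧ c.1 ≠ c'.2 ∧ c.2 ≠ c'.1 ∧ c.2 ≠ c'.2

variable {α : Type u} [LinearOrder α]

/-- The contents of the registers after all comparators of the stage have worked in parallel on
the contents `x`. In a valid stage each register lies on at most one comparator, so the `inf'`
and `sup'` range over one comparator only; see `apply_fst`, `apply_snd`, `apply_of_notMem`. -/
def apply (S : Stage) (x : ℕ → α) : ℕ → α := fun r =>
  if h : (S.filter fun c => c.1 = r).Nonempty then
    (S.filter fun c => c.1 = r).inf' h fun c => min (x c.1) (x c.2)
  else if h : (S.filter fun c => c.2 = r).Nonempty then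
    (S.filter fun c => c.2 = r).sup' h fun c => max (x c.1) (x c.2)
  else x r

theorem apply_fst {S : Stage} (hS : S.IsValid) (x : ℕ → α) {c : ℕ × ℕ} (hc : c ∈ S) :
    S.apply x c.1 = min (x c.1) (x c.2) := by
  have h : (S.filter fun c' => c'.1 = c.1) = {c} := by
    ext c'
    simp only [Finset.mem_filter, Finset.mem_singleton]
    constructor
    · rintro ⟨h1, h2⟩
      by_contra hne
      exact (hS.2 c' h1 c hc hne).1 h2
    · rintro rfl
      exact ⟨hc, rfl⟩
  simp [apply, h]

theorem apply_snd {S : Stage} (hS : S.IsValid) (x : ℕ → α) {c : ℕ × ℕ} (hc : c ∈ S) :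
    S.apply x c.2 = max (x c.1) (x c.2) := by
  have h : (S.filter fun c' => c'.2 = c.2) = {c} := by
    ext c'
    simp only [Finset.mem_filter, Finset.mem_singleton]
    constructor
    · rintro ⟨h1, h2⟩
      by_contra hne
      exact (hS.2 c' h1 c hc hne).2.2.2 h2
    · rintro rfl
      exact ⟨hc, rfl⟩
  have h0 : (S.filter fun c' => c'.1 = c.2) = ∅ := by
    ext c'
    simp only [Finset.mem_filter, Finset.notMem_empty, iff_false, not_and]
    intro h1 h2
    by_cases hne : c' = c
    · subst hne
      exact hS.1 _ h1 h2
    · exact (hS.2 c' h1 c hc hne).2.1 h2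
  simp [apply, h, h0]

theorem apply_of_notMem {S : Stage} (x : ℕ → α) {r : ℕ} (hr : r ∉ S.regs) :
    S.apply x r = x r := by
  simp only [regs, Finset.mem_union, Finset.mem_image, not_or, not_exists, not_and] at hr
  have h1 : (S.filter fun c => c.1 = r) = ∅ := Finset.filter_eq_empty_iff.2 fun c hc => hr.1 c hc
  have h2 : (S.filter fun c => c.2 = r) = ∅ := Finset.filter_eq_empty_iff.2 fun c hc => hr.2 c hc
  simp [apply, h1, h2]

end Stage

/-- A comparator network: a finite set of registers (numbered by natural numbers) and a sequence
of stages `stage 1, …, stage depth`. The values of `stage` at other indices are irrelevant. -/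
structure ComparatorNetwork where
  /-- The registers of the network. -/
  registers : Finset ℕ
  /-- The number of stages, which is the running time of the network. -/
  depth : ℕ
  /-- The stages, numbered from `1` to `depth`. -/
  stage : ℕ → Stage

namespace ComparatorNetwork

/-- Every stage consists of comparators that connect disjoint pairs of registers of the network. -/
def IsValid (A : ComparatorNetwork) : Prop :=
  ∀ i ∈ Finset.Icc 1 A.depth, (A.stage i).IsValid ∧ (A.stage i).regs ⊆ A.registers

/-- The contents of the registers after the first `d` stages. -/
def runUpTo {α : Type u} [LinearOrder α] (A : ComparatorNetwork) (x : ℕ → α) : ℕ → (ℕ → α)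
  | 0 => x
  | d + 1 => (A.stage (d + 1)).apply (A.runUpTo x d)

/-- The output of the network, the stages being run one after another, on the input `x`. -/
def output {α : Type u} [LinearOrder α] (A : ComparatorNetwork) (x : ℕ → α) : ℕ → α :=
  A.runUpTo x A.depth

/-- The network is `p`-periodic: `p` is less than the number of stages, and stages `i` and
`i + p` are identical. -/
def IsPeriodic (A : ComparatorNetwork) (p : ℕ) : Prop :=
  p < A.depth ∧ ∀ i, 1 ≤ i → i + p ≤ A.depth → A.stage i = A.stage (i + p)

/-- The network that runs the whole of `A` repeatedly, `t` times (`t` passes of `A`). -/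
def passes (A : ComparatorNetwork) (t : ℕ) : ComparatorNetwork where
  registers := A.registers
  depth := t * A.depth
  stage i := A.stage ((i - 1) % A.depth + 1)

/-- The numbers of the stages in which register `r` is used. -/
def usedAt (A : ComparatorNetwork) (r : ℕ) : Finset ℕ :=
  (Finset.Icc 1 A.depth).filter fun i => r ∈ (A.stage i).regs

/-- The delay: the maximum over all registers `r` of `lst r - fst r + 1`, where `fst r` and
`lst r` are the numbers of the first and of the last stage in which `r` is used
(unused registers do not count). -/
def delay (A : ComparatorNetwork) : ℕ :=
  A.registers.sup fun r =>
    if h : (A.usedAt r).Nonempty then (A.usedAt r).max' h - (A.usedAt r).min' h + 1 else 0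

/-- The compact form of `A = S_1, …, S_d` is `T_1, …, T_D`, where `D` is the delay of `A` and
`T_q` is the union of all `S_{q + p D}` with `0 ≤ p ≤ (d - q) / D`. -/
def compactForm (A : ComparatorNetwork) : ComparatorNetwork where
  registers := A.registers
  depth := A.delay
  stage q := (Finset.range ((A.depth - q) / A.delay + 1)).biUnion fun p =>
    A.stage (q + p * A.delay)

/-- Delete the registers in `R`, and all comparators that touch them. -/
def deleteRegisters (A : ComparatorNetwork) (R : Finset ℕ) : ComparatorNetwork where
  registers := A.registers \ R
  depth := A.depth
  stage i := (A.stage i).filter fun c => c.1 ∉ R ∧ c.2 ∉ R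

/-- The network merges any two sorted sequences (over any linearly ordered set) that are given in
its registers with odd and with even numbers, respectively: the output is sorted and consists of
the same items as the input. -/
def MergesOddEven (A : ComparatorNetwork) : Prop :=
  ∀ (α : Type u) [LinearOrder α] (x : ℕ → α),
    MonotoneOn x {r | r ∈ A.registers ∧ Odd r} →
    MonotoneOn x {r | r ∈ A.registers ∧ Even r} →
      MonotoneOn (A.output x) {r | r ∈ A.registers} ∧
        A.registers.val.map (A.output x) = A.registers.val.map x

end ComparatorNetwork

namespace PeriodicMerger

/-- `n_k = 2^(k-1) - 1`. -/
def n (k : ℕ) : ℕ := 2 ^ (k - 1) - 1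

/-- `b_k = 2 (k - 2)`. -/
def b (k : ℕ) : ℕ := 2 * (k - 2)

/-- `S_{k,1} = {[b i : b i + 1] : i = 1, …, n - 1}`. -/
def firstStage (k : ℕ) : Stage :=
  (Finset.Icc 1 (n k - 1)).image fun i => (b k * i, b k * i + 1)

/-- The long comparators `S_{k,2j} =
{[b i + j : b (i + 2^(k-j-1) - 1) + (b - j + 1)] : i = 0, …, n - 2^(k-j-1)}`. -/
def longStage (k j : ℕ) : Stage :=
  (Finset.Icc 0 (n k - 2 ^ (k - j - 1))).image fun i =>
    (b k * i + j, b k * (i + 2 ^ (k - j - 1) - 1) + (b k - j + 1))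

/-- The short comparators `S_{k,2j+1} =
{[b i + j : b i + j + 1], [b i + (b - j) : b i + (b - j + 1)] : i = 0, …, n - 1}`. -/
def shortStage (k j : ℕ) : Stage :=
  ((Finset.Icc 0 (n k - 1)).image fun i => (b k * i + j, b k * i + j + 1)) ∪
    (Finset.Icc 0 (n k - 1)).image fun i => (b k * i + (b k - j), b k * i + (b k - j + 1))

/-- The network `P_k`, on the `n b + 2` registers `0, …, n b + 1`, with the stages
`S_{k,1} ∪ {[0:1], [n b : n b + 1]}, S_{k,2}, …, S_{k,2k-3}`. -/
def P (k : ℕ) : ComparatorNetwork where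
  registers := Finset.range (n k * b k + 2)
  depth := 2 * k - 3
  stage m :=
    if m = 1 then firstStage k ∪ {(0, 1), (n k * b k, n k * b k + 1)}
    else if m % 2 = 0 then longStage k (m / 2)
    else shortStage k (m / 2)

/-- The network `M_k`: the compact form of `P_k` with the first and the last register deleted. -/
def M (k : ℕ) : ComparatorNetwork :=
  (P k).compactForm.deleteRegisters {0, n k * b k + 1}

end PeriodicMerger

/-!
Put register `2 * K * i + c`, where `K = k - 2` and `1 ≤ c ≤ 2 * K`, into row `i` and column `c` of
a grid with `n` rows. Fix a threshold `a`. If in every column the items that are at least `a` fill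
the rows from some row on, then one number per column, its level, describes where they are, and a
comparator that joins the rows `i` of column `c` with the rows `i + δ` of column `c'` replaces the
levels `C` and `C'` by `min C (C' + δ)` and `max C' (C - δ)`. Only the integer part of a level
matters. For an input with sorted odd and even registers, this freedom allows fractional initial
levels whose sum over opposite columns `c` and `2 * K + 1 - c` is constant. The network preserves
this symmetry and therefore acts on only `K` numbers `v 1, …, v K`, the centred levels of the
columns `1, …, K`: the long comparators fold `v j` at `2 ^ (K - j)`, and the short ones sort
neighbouring numbers and fold `v K` at `1 / 2` and `v 1` at `0`. Initially `|v j| ≤ 2 ^ K`, so the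
folds shrink all numbers to the interval from `0` to `1 / 2`, and the steps that follow sort them.
After `6 * K - 3` steps `0 ≤ v 1 ≤ … ≤ v K ≤ 1 / 2`, which says that the items at least `a` form a
final segment of the registers. As `a` was arbitrary, the output is sorted.
-/

namespace Stage

variable {α : Type u} [LinearOrder α] {S T : Stage} {R : Finset ℕ} {c : ℕ × ℕ} {r : ℕ}

theorem mem_regs : r ∈ S.regs ↔ (∃ y, (r, y) ∈ S) ∨ ∃ x, (x, r) ∈ S := by
  simp [regs]

theorem IsValid.mono (hT : T.IsValid) (h : S ⊆ T) : S.IsValid :=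
  ⟨fun c hc => hT.1 c (h hc), fun c hc d hd => hT.2 c (h hc) d (h hd)⟩

theorem IsValid.notMem_regs_of_insert (hc : c ∉ S) (hS : IsValid (insert c S)) :
    c.1 ∉ S.regs ∧ c.2 ∉ S.regs := by
  have hcS : ∀ d ∈ S, c.1 ≠ d.1 ∧ c.1 ≠ d.2 ∧ c.2 ≠ d.1 ∧ c.2 ≠ d.2 := fun d hd =>
    hS.2 c (Finset.mem_insert_self c S) d (Finset.mem_insert_of_mem hd) fun h => hc (h ▸ hd)
  simp only [mem_regs, not_or, not_exists]
  exact ⟨⟨fun y hd => (hcS _ hd).1 rfl, fun x hd => (hcS _ hd).2.1 rfl⟩,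
    fun y hd => (hcS _ hd).2.2.1 rfl, fun x hd => (hcS _ hd).2.2.2 rfl⟩

theorem apply_insert (hc : c ∉ S) (hS : IsValid (insert c S)) (x : ℕ → α) :
    apply (insert c S) x = apply {c} (S.apply x) := by
  have hcS : c ∈ insert c S := Finset.mem_insert_self c S
  have hS' : S.IsValid := hS.mono (Finset.subset_insert c S)
  have hc' : IsValid {c} := hS.mono (Finset.singleton_subset_iff.2 hcS)
  obtain ⟨h1, h2⟩ := hS.notMem_regs_of_insert hc
  ext r
  by_cases hr : r ∈ regs {c}
  · obtain rfl | rfl : r = c.1 ∨ r = c.2 := by simpa [regs] using hr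
    · rw [apply_fst hS x hcS, apply_fst hc' _ (Finset.mem_singleton_self c),
        apply_of_notMem x h1, apply_of_notMem x h2]
    · rw [apply_snd hS x hcS, apply_snd hc' _ (Finset.mem_singleton_self c),
        apply_of_notMem x h1, apply_of_notMem x h2]
  · rw [apply_of_notMem _ hr]
    by_cases hrS : r ∈ S.regs
    · obtain ⟨y, hd⟩ | ⟨y, hd⟩ := mem_regs.1 hrS
      · exact (apply_fst hS x (Finset.mem_insert_of_mem hd)).trans (apply_fst hS' x hd).symm
      · exact (apply_snd hS x (Finset.mem_insert_of_mem hd)).trans (apply_snd hS' x hd).symm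
    · have hrS' : r ∉ regs (insert c S) := by
        simp only [mem_regs, Finset.mem_insert, Finset.mem_singleton] at hr hrS ⊢
        grind
      rw [apply_of_notMem x hrS, apply_of_notMem x hrS']

theorem apply_singleton (hc : c.1 ≠ c.2) (x : ℕ → α) :
    apply {c} x = if x c.1 ≤ x c.2 then x else x ∘ Equiv.swap c.1 c.2 := by
  have hS : IsValid {c} := by simp [IsValid, hc]
  have hcc : c ∈ ({c} : Stage) := Finset.mem_singleton_self c
  ext r
  by_cases hr : r ∈ regs {c}
  · obtain rfl | rfl : r = c.1 ∨ r = c.2 := by simpa [regs] using hr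
    · rw [apply_fst hS x hcc]
      split_ifs with h
      · exact min_eq_left h
      · simpa using (not_le.1 h).le
    · rw [apply_snd hS x hcc]
      split_ifs with h
      · exact max_eq_right h
      · simpa using (not_le.1 h).le
  · rw [apply_of_notMem x hr]
    obtain ⟨h1, h2⟩ : r ≠ c.1 ∧ r ≠ c.2 := by simpa [regs] using hr
    split_ifs
    · rfl
    · rw [Function.comp_apply, Equiv.swap_apply_of_ne_of_ne h1 h2]

theorem map_apply_singleton (hc : c.1 ≠ c.2) (h1 : c.1 ∈ R) (h2 : c.2 ∈ R) (x : ℕ → α) :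
    R.val.map (apply {c} x) = R.val.map x := by
  rw [apply_singleton hc]
  split_ifs
  · rfl
  · have hswap : R.map (Equiv.swap c.1 c.2).toEmbedding = R :=
      Finset.map_perm fun r hr => by
        obtain rfl | rfl := (Equiv.swap_apply_ne_self_iff.1 hr).2 <;> assumption
    conv_rhs => rw [← hswap, Finset.map_val, Multiset.map_map]
    rfl

theorem map_apply (hS : S.IsValid) (hR : S.regs ⊆ R) (x : ℕ → α) :
    R.val.map (S.apply x) = R.val.map x := by
  induction S using Finset.induction_on with
  | empty => exact Multiset.map_congr rfl fun r _ => apply_of_notMem x (by simp [regs])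
  | insert c S hc ih =>
    have hcS : c ∈ insert c S := Finset.mem_insert_self c S
    rw [apply_insert hc hS,
      map_apply_singleton (hS.1 c hcS) (hR (mem_regs.2 (Or.inl ⟨_, hcS⟩)))
        (hR (mem_regs.2 (Or.inr ⟨_, hcS⟩)))]
    refine ih (hS.mono (Finset.subset_insert c S)) fun r hr => hR ?_
    exact mem_regs.2 ((mem_regs.1 hr).imp (Exists.imp fun _ => Finset.mem_insert_of_mem)
      (Exists.imp fun _ => Finset.mem_insert_of_mem))

end Stage

namespace ComparatorNetwork

variable {α : Type u} [LinearOrder α] {A : ComparatorNetwork}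

theorem map_output (hA : A.IsValid) (x : ℕ → α) :
    A.registers.val.map (A.output x) = A.registers.val.map x := by
  suffices ∀ d ≤ A.depth, A.registers.val.map (A.runUpTo x d) = A.registers.val.map x from
    this _ le_rfl
  intro d hd
  induction d with
  | zero => rfl
  | succ d ih =>
    obtain ⟨hvalid, hregs⟩ := hA (d + 1) (Finset.mem_Icc.2 ⟨by omega, hd⟩)
    exact (Stage.map_apply hvalid hregs _).trans (ih (by omega))

theorem IsValid.passes (hA : A.IsValid) (t : ℕ) : (A.passes t).IsValid := by
  intro i hi
  have hpos : 0 < A.depth := by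
    obtain ⟨h1, h2⟩ : 1 ≤ i ∧ i ≤ t * A.depth := Finset.mem_Icc.1 hi
    exact Nat.pos_of_mul_pos_left (h1.trans h2)
  exact hA _ (Finset.mem_Icc.2 ⟨Nat.le_add_left _ _, Nat.mod_lt _ hpos⟩)

theorem isPeriodic_passes (hA : 0 < A.depth) {t : ℕ} (ht : 2 ≤ t) :
    (A.passes t).IsPeriodic A.depth := by
  refine ⟨lt_mul_of_one_lt_left hA ht, fun i hi _ => ?_⟩
  simp only [passes]
  rw [Nat.sub_add_comm hi, Nat.add_mod_right]

theorem delay_le {D : ℕ} (h : ∀ r, ∀ i ∈ A.usedAt r, ∀ j ∈ A.usedAt r, j < i + D) :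
    A.delay ≤ D := by
  refine Finset.sup_le fun r _ => ?_
  split_ifs with hr
  · have hlt := h r _ (Finset.min'_mem _ hr) _ (Finset.max'_mem _ hr)
    have hle := Finset.min'_le _ _ (Finset.max'_mem _ hr)
    omega
  · exact D.zero_le

theorem lt_add_delay {r i j : ℕ} (hr : r ∈ A.registers) (hi : i ∈ A.usedAt r)
    (hj : j ∈ A.usedAt r) : j < i + A.delay := by
  have hle := Finset.le_sup (f := fun r => if h : (A.usedAt r).Nonempty then
    (A.usedAt r).max' h - (A.usedAt r).min' h + 1 else 0) hr
  simp only [dif_pos (show (A.usedAt r).Nonempty from ⟨i, hi⟩)] at hle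
  change _ ≤ A.delay at hle
  have hmin := Finset.min'_le _ _ hi
  have hmax := Finset.le_max' _ _ hj
  omega

theorem mem_stage_compactForm {q : ℕ} {c : ℕ × ℕ} (hq : 1 ≤ q) (hqD : q ≤ A.delay)
    (hqd : q ≤ A.depth) :
    c ∈ A.compactForm.stage q ↔
      ∃ m, 1 ≤ m ∧ m ≤ A.depth ∧ m % A.delay = q % A.delay ∧ c ∈ A.stage m := by
  have hD : 0 < A.delay := by omega
  simp only [compactForm, Finset.mem_biUnion, Finset.mem_range, Nat.lt_succ_iff,
    Nat.le_div_iff_mul_le hD]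
  constructor
  · rintro ⟨p, hp, hc⟩
    exact ⟨q + p * A.delay, by omega, by omega, Nat.add_mul_mod_self_right _ _ _, hc⟩
  · rintro ⟨m, hm, hmd, hmod, hc⟩
    have hqm : q ≤ m := by
      by_contra! hlt
      obtain rfl | hqD := hqD.eq_or_lt
      · rw [Nat.mod_self, Nat.mod_eq_of_lt hlt] at hmod
        omega
      · rw [Nat.mod_eq_of_lt hqD, Nat.mod_eq_of_lt (hlt.trans hqD)] at hmod
        omega
    obtain ⟨p, hp⟩ := (Nat.modEq_iff_dvd' hqm).1 hmod.symm
    obtain rfl : m = q + p * A.delay := by rw [mul_comm, ← hp]; omega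
    exact ⟨p, by omega, hc⟩

end ComparatorNetwork

namespace PeriodicMerger

/-! ### Stages on a grid of registers -/

section Grid

variable {w N i i' c c' δ r : ℕ}

theorem le_of_mul_add_le (hc : 1 ≤ c) (hc' : c' ≤ w) (h : w * i + c ≤ w * i' + c') : i ≤ i' := by
  by_contra! hlt
  have hmul : w * i' + w ≤ w * i := Nat.mul_le_mul_left w hlt
  omega

theorem mul_add_inj (hc : c ∈ Set.Icc 1 w) (hc' : c' ∈ Set.Icc 1 w)
    (h : w * i + c = w * i' + c') : i = i' ∧ c = c' := by
  obtain rfl : i = i' :=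
    (le_of_mul_add_le hc.1 hc'.2 h.le).antisymm (le_of_mul_add_le hc'.1 hc.2 h.ge)
  exact ⟨rfl, Nat.add_left_cancel h⟩

theorem mul_add_mem_Icc (hi : i < N) (hc : c ∈ Set.Icc 1 w) : w * i + c ∈ Set.Icc 1 (w * N) := by
  have hmul : w * i + w ≤ w * N := Nat.mul_le_mul_left w hi
  exact ⟨le_add_left hc.1, by linarith [hc.2]⟩

theorem exists_eq_mul_add (hr : r ∈ Set.Icc 1 (w * N)) :
    ∃ i < N, ∃ c ∈ Set.Icc 1 w, r = w * i + c := by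
  obtain ⟨h1, hN⟩ := hr
  have hw : 0 < w := Nat.pos_of_mul_pos_right (h1.trans hN)
  have hdiv := Nat.div_add_mod (r - 1) w
  have hmod := Nat.mod_lt (r - 1) hw
  refine ⟨(r - 1) / w, Nat.div_lt_of_lt_mul (by omega), (r - 1) % w + 1, ⟨?_, ?_⟩, ?_⟩ <;> omega

/-- A set of disjoint directed links between the columns `1, …, w` of a grid that covers all
columns. `L c c' δ` says that column `c` is linked to column `c'`, `δ` rows further down. -/
structure IsColumnMatching (w : ℕ) (L : ℕ → ℕ → ℕ → Prop) : Prop where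
  left_mem : ∀ {c c' δ}, L c c' δ → c ∈ Set.Icc 1 w
  right_mem : ∀ {c c' δ}, L c c' δ → c' ∈ Set.Icc 1 w
  left_unique : ∀ {c c' d' δ ε}, L c c' δ → L c d' ε → c' = d' ∧ δ = ε
  right_unique : ∀ {c d c' δ ε}, L c c' δ → L d c' ε → c = d ∧ δ = ε
  disjoint : ∀ {c c' d δ ε}, L c c' δ → ¬ L d c ε
  exists_link : ∀ {c}, c ∈ Set.Icc 1 w → ∃ d δ, L c d δ ∨ L d c δ

/-- The grid has `N` rows and `w` columns, and the register in row `i < N` and column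
`c ∈ {1, …, w}` is `w * i + c`. The stage is a grid stage for the links `L` if every link
`L c c' δ` contributes one comparator for each row `i`, as far as row `i + δ` exists. -/
def IsGridStage (w N : ℕ) (L : ℕ → ℕ → ℕ → Prop) (S : Stage) : Prop :=
  ∀ x y, (x, y) ∈ S ↔
    ∃ i c c' δ, L c c' δ ∧ i + δ < N ∧ x = w * i + c ∧ y = w * (i + δ) + c'

namespace IsGridStage

variable {L : ℕ → ℕ → ℕ → Prop} {S : Stage}

theorem comparator_mem (hS : IsGridStage w N L S) (h : L c c' δ) (hi : i + δ < N) :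
    (w * i + c, w * (i + δ) + c') ∈ S :=
  (hS _ _).2 ⟨i, c, c', δ, h, hi, rfl, rfl⟩

theorem isValid (hS : IsGridStage w N L S) (hL : IsColumnMatching w L) : S.IsValid := by
  constructor
  · rintro ⟨_, _⟩ hx h
    obtain ⟨i, c, c', δ, hl, -, rfl, rfl⟩ := (hS _ _).1 hx
    obtain ⟨-, rfl⟩ := mul_add_inj (hL.left_mem hl) (hL.right_mem hl) h
    exact hL.disjoint hl hl
  · rintro ⟨_, _⟩ hx ⟨_, _⟩ hx' hne
    obtain ⟨i, c, c', δ, hl, -, rfl, rfl⟩ := (hS _ _).1 hx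
    obtain ⟨k, d, d', ε, hm, -, rfl, rfl⟩ := (hS _ _).1 hx'
    refine ⟨fun h => hne ?_, fun h => ?_, fun h => ?_, fun h => hne ?_⟩
    · obtain ⟨rfl, rfl⟩ := mul_add_inj (hL.left_mem hl) (hL.left_mem hm) h
      obtain ⟨rfl, rfl⟩ := hL.left_unique hl hm
      rfl
    · obtain ⟨-, rfl⟩ := mul_add_inj (hL.left_mem hl) (hL.right_mem hm) h
      exact hL.disjoint hl hm
    · obtain ⟨-, rfl⟩ := mul_add_inj (hL.right_mem hl) (hL.left_mem hm) h
      exact hL.disjoint hm hl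
    · obtain ⟨hik, rfl⟩ := mul_add_inj (hL.right_mem hl) (hL.right_mem hm) h
      obtain ⟨rfl, rfl⟩ := hL.right_unique hl hm
      rw [Nat.add_right_cancel hik]

theorem regs_subset (hS : IsGridStage w N L S) (hL : IsColumnMatching w L) :
    S.regs ⊆ Finset.Icc 1 (w * N) := by
  intro r hr
  rw [← Finset.mem_coe, Finset.coe_Icc]
  obtain ⟨y, hy⟩ | ⟨x, hx⟩ := Stage.mem_regs.1 hr
  · obtain ⟨i, c, c', δ, hl, hi, rfl, -⟩ := (hS _ _).1 hy
    exact mul_add_mem_Icc (by omega) (hL.left_mem hl)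
  · obtain ⟨i, c, c', δ, hl, hi, -, rfl⟩ := (hS _ _).1 hx
    exact mul_add_mem_Icc hi (hL.right_mem hl)

theorem notMem_regs_left (hS : IsGridStage w N L S) (hL : IsColumnMatching w L) (h : L c c' δ)
    (hi : N ≤ i + δ) : w * i + c ∉ S.regs := by
  rw [Stage.mem_regs]
  rintro (⟨y, hy⟩ | ⟨x, hx⟩)
  · obtain ⟨k, d, d', ε, hm, hk, heq, -⟩ := (hS _ _).1 hy
    obtain ⟨rfl, rfl⟩ := mul_add_inj (hL.left_mem h) (hL.left_mem hm) heq
    obtain ⟨-, rfl⟩ := hL.left_unique h hm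
    exact hk.not_ge hi
  · obtain ⟨k, d, d', ε, hm, -, -, heq⟩ := (hS _ _).1 hx
    obtain ⟨-, rfl⟩ := mul_add_inj (hL.left_mem h) (hL.right_mem hm) heq
    exact hL.disjoint h hm

theorem notMem_regs_right (hS : IsGridStage w N L S) (hL : IsColumnMatching w L) (h : L c c' δ)
    (hi : i < δ) : w * i + c' ∉ S.regs := by
  rw [Stage.mem_regs]
  rintro (⟨y, hy⟩ | ⟨x, hx⟩)
  · obtain ⟨k, d, d', ε, hm, -, heq, -⟩ := (hS _ _).1 hy
    obtain ⟨-, rfl⟩ := mul_add_inj (hL.right_mem h) (hL.left_mem hm) heq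
    exact hL.disjoint hm h
  · obtain ⟨k, d, d', ε, hm, -, -, heq⟩ := (hS _ _).1 hx
    obtain ⟨rfl, rfl⟩ := mul_add_inj (hL.right_mem h) (hL.right_mem hm) heq
    obtain ⟨-, rfl⟩ := hL.right_unique h hm
    omega

end IsGridStage

end Grid

section HasLevels

variable {α : Type u} [LinearOrder α] {R : Type*} [Field R] [LinearOrder R]
  {w N i c c' δ : ℕ} {L : ℕ → ℕ → ℕ → Prop} {S : Stage} {C C' : ℕ → R} {a : α} {x : ℕ → α}

/-- In every column `c` of the grid, the items that are at least `a` are those in the rows from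
`N - C c` on. The level `C c` need not be an integer: all numbers with the same integer part
describe the same contents. -/
def HasLevels (w N : ℕ) (a : α) (x : ℕ → α) (C : ℕ → R) : Prop :=
  ∀ i < N, ∀ c ∈ Set.Icc 1 w, (a ≤ x (w * i + c) ↔ (N : R) ≤ i + C c)

/-- The effect of a grid stage with links `L` on the levels of the columns. -/
def LevelStep (L : ℕ → ℕ → ℕ → Prop) (C C' : ℕ → R) : Prop :=
  ∀ c c' δ, L c c' δ → C' c = min (C c) (C c' + δ) ∧ C' c' = max (C c') (C c - δ)

variable [IsStrictOrderedRing R]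

theorem LevelStep.mem_Ico {B : R} (h : LevelStep L C C') (hL : IsColumnMatching w L)
    (hC : ∀ c ∈ Set.Icc 1 w, C c ∈ Set.Ico 0 B) : ∀ c ∈ Set.Icc 1 w, C' c ∈ Set.Ico 0 B := by
  intro c hc
  obtain ⟨c', δ, hl | hl⟩ := hL.exists_link hc
  · rw [(h _ _ _ hl).1]
    exact ⟨le_min (hC c hc).1 (add_nonneg (hC c' (hL.right_mem hl)).1 δ.cast_nonneg),
      (min_le_left _ _).trans_lt (hC c hc).2⟩
  · rw [(h _ _ _ hl).2]
    exact ⟨le_max_of_le_left (hC c hc).1,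
      max_lt (hC c hc).2 ((sub_le_self _ δ.cast_nonneg).trans_lt (hC c' (hL.left_mem hl)).2)⟩

theorem HasLevels.le_apply_left_iff (hx : HasLevels w N a x C) (hS : IsGridStage w N L S)
    (hL : IsColumnMatching w L) (hl : L c c' δ) (hC : 0 ≤ C c') (hi : i < N) :
    a ≤ S.apply x (w * i + c) ↔ (N : R) ≤ i + min (C c) (C c' + δ) := by
  have hxc := hx i hi c (hL.left_mem hl)
  rw [← min_add_add_left, le_min_iff, ← hxc]
  by_cases hiδ : i + δ < N
  · rw [Stage.apply_fst (hS.isValid hL) x (hS.comparator_mem hl hiδ), le_min_iff,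
      hx (i + δ) hiδ c' (hL.right_mem hl), Nat.cast_add, add_assoc, add_comm (C c')]
  · rw [Stage.apply_of_notMem x (hS.notMem_regs_left hL hl (not_lt.1 hiδ)), iff_self_and]
    have hN : (N : R) ≤ i + δ := by exact_mod_cast not_lt.1 hiδ
    exact fun _ => by linarith

theorem HasLevels.le_apply_right_iff (hx : HasLevels w N a x C) (hS : IsGridStage w N L S)
    (hL : IsColumnMatching w L) (hl : L c c' δ) (hC : C c < N + 1) (hi : i < N) :
    a ≤ S.apply x (w * i + c') ↔ (N : R) ≤ i + max (C c') (C c - δ) := by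
  have hxc' := hx i hi c' (hL.right_mem hl)
  rw [← max_add_add_left, le_max_iff, ← hxc']
  by_cases hδi : δ ≤ i
  · obtain ⟨k, rfl⟩ := Nat.exists_eq_add_of_le' hδi
    rw [Stage.apply_snd (hS.isValid hL) x (hS.comparator_mem hl hi), le_max_iff,
      hx k (by omega) c (hL.left_mem hl), or_comm, Nat.cast_add, add_add_sub_cancel]
  · rw [Stage.apply_of_notMem x (hS.notMem_regs_right hL hl (not_le.1 hδi)), iff_self_or]
    have hi1 : (i : R) + 1 ≤ δ := by exact_mod_cast not_le.1 hδi
    exact fun h => by linarith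

theorem HasLevels.apply (hx : HasLevels w N a x C) (hS : IsGridStage w N L S)
    (hL : IsColumnMatching w L) (hC : ∀ c ∈ Set.Icc 1 w, C c ∈ Set.Ico 0 (N + 1 : R))
    (h : LevelStep L C C') : HasLevels w N a (S.apply x) C' := by
  intro i hi c hc
  obtain ⟨c', δ, hl | hl⟩ := hL.exists_link hc
  · rw [(h _ _ _ hl).1, hx.le_apply_left_iff hS hL hl (hC c' (hL.right_mem hl)).1 hi]
  · rw [(h _ _ _ hl).2, hx.le_apply_right_iff hS hL hl (hC c' (hL.left_mem hl)).2 hi]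

theorem monotoneOn_of_forall_exists_hasLevels
    (h : ∀ a, ∃ C : ℕ → R, HasLevels w N a x C ∧ MonotoneOn C (Set.Icc 1 w) ∧ C w ≤ C 1 + 1) :
    MonotoneOn x (Set.Icc 1 (w * N)) := by
  intro r hr r' hr' hrr'
  obtain ⟨i, hi, c, hc, rfl⟩ := exists_eq_mul_add hr
  obtain ⟨i', hi', c', hc', rfl⟩ := exists_eq_mul_add hr'
  obtain ⟨C, hx, hmono, hwrap⟩ := h (x (w * i + c))
  refine (hx i' hi' c' hc').2 (((hx i hi c hc).1 le_rfl).trans ?_)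
  obtain rfl | hlt := (le_of_mul_add_le hc.1 hc'.2 hrr').eq_or_lt
  · exact add_le_add_right (hmono hc hc' (Nat.le_of_add_le_add_left hrr')) _
  · have hii' : (i : R) + 1 ≤ i' := by exact_mod_cast hlt
    have hw : 1 ≤ w := hc.1.trans hc.2
    have h1 : C c ≤ C w := hmono hc ⟨hw, le_rfl⟩ hc.2
    have h2 : C 1 ≤ C c' := hmono ⟨le_rfl, hw⟩ hc' hc'.1
    linarith

end HasLevels

/-! ### The folding dynamics -/

section Fold

variable {R : Type*} [Field R] [LinearOrder R] {K q t j : ℕ} {v : ℕ → R}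

/-- One step of the folding dynamics on `K` numbers `v 1, …, v K`. As `q` runs through the
integers, each `v j` passes through three phases: for `q ≡ 2 j` it is folded at `2 ^ (K - j)`,
for `q ≡ 2 j + 1` it is sorted with `v (j + 1)`, and for `q ≡ 2 j + 2` with `v (j - 1)`, modulo
`3`. At the ends, `v K` is folded at `1 / 2`, and `v 1` at `0` from below. -/
def foldStep (K q : ℕ) (v : ℕ → R) (j : ℕ) : R :=
  if q % 3 = 2 * j % 3 then min (v j) (2 ^ (K + 1 - j) - v j)
  else if q % 3 = (2 * j + 1) % 3 then
    if j < K then min (v j) (v (j + 1)) else min (v j) (1 - v j)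
  else if j = 1 then |v 1| else max (v (j - 1)) (v j)

/-- The state of the folding dynamics after a given number of steps, from the state `v`. -/
def foldRun (K : ℕ) (v : ℕ → R) : ℕ → ℕ → R
  | 0 => v
  | t + 1 => foldStep K (t + 1) (foldRun K v t)

theorem foldRun_succ : foldRun K v (t + 1) = foldStep K (t + 1) (foldRun K v t) := rfl

theorem foldStep_fold (h : q % 3 = 2 * j % 3) :
    foldStep K q v j = min (v j) (2 ^ (K + 1 - j) - v j) :=
  if_pos h

theorem foldStep_min (hj : j < K) (h : q % 3 = (2 * j + 1) % 3) :
    foldStep K q v j = min (v j) (v (j + 1)) := by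
  rw [foldStep, if_neg (by omega), if_pos h, if_pos hj]

theorem foldStep_last (h : q % 3 = (2 * K + 1) % 3) :
    foldStep K q v K = min (v K) (1 - v K) := by
  rw [foldStep, if_neg (by omega), if_pos h, if_neg (lt_irrefl K)]

theorem foldStep_max (hj : 1 ≤ j) (h : q % 3 = (2 * j + 1) % 3) :
    foldStep K q v (j + 1) = max (v j) (v (j + 1)) := by
  rw [foldStep, if_neg (by omega), if_neg (by omega), if_neg (by omega), Nat.add_sub_cancel]

theorem foldStep_first (h : q % 3 = 1) : foldStep K q v 1 = |v 1| := by
  rw [foldStep, if_neg (by omega), if_neg (by omega), if_pos rfl]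

theorem foldStep_le_self_of_min (hj : j ≤ K) (h : q % 3 = (2 * j + 1) % 3) :
    foldStep K q v j ≤ v j := by
  obtain rfl | hj := hj.eq_or_lt
  · exact (foldStep_last h).trans_le (min_le_left _ _)
  · exact (foldStep_min hj h).trans_le (min_le_left _ _)

theorem foldRun_le_succ_after_min (hj : 1 ≤ j) (hjK : j < K) (ht : 1 ≤ t)
    (h : t % 3 = (2 * j + 1) % 3) : foldRun K v t j ≤ foldRun K v t (j + 1) := by
  obtain ⟨t, rfl⟩ := Nat.exists_eq_add_of_le' ht
  rw [foldRun_succ, foldStep_min hjK h, foldStep_max hj h]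
  exact min_le_max

variable [IsStrictOrderedRing R]

theorem abs_min_sub_le {p y B : R} (hp : 0 ≤ p) (hy : |y| ≤ B) : |min y (p - y)| ≤ B := by
  rw [abs_le] at hy ⊢
  exact ⟨le_min hy.1 (by linarith), (min_le_left _ _).trans hy.2⟩

theorem abs_foldStep_le {B : R} (hv : ∀ j ∈ Set.Icc 1 K, |v j| ≤ B) :
    ∀ j ∈ Set.Icc 1 K, |foldStep K q v j| ≤ B := by
  rintro j ⟨hj, hjK⟩
  have hvj := hv j ⟨hj, hjK⟩
  rw [foldStep]
  split_ifs with _ _ hlt h1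
  · exact abs_min_sub_le (by positivity) hvj
  · exact abs_min_le_max_abs_abs.trans (max_le hvj (hv _ ⟨by omega, hlt⟩))
  · exact abs_min_sub_le zero_le_one hvj
  · rw [abs_abs]
    exact h1 ▸ hvj
  · exact abs_max_le_max_abs_abs.trans (max_le (hv _ ⟨by omega, by omega⟩) hvj)

theorem abs_foldRun_le {B : R} (hv : ∀ j ∈ Set.Icc 1 K, |v j| ≤ B) (t : ℕ) :
    ∀ j ∈ Set.Icc 1 K, |foldRun K v t j| ≤ B := by
  induction t with
  | zero => exact hv
  | succ t ih => exact abs_foldStep_le ih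

theorem min_sub_le_half {p y z : R} (hp : p ≤ 2 * z) : min y (p - y) ≤ z := by
  rcases le_total y z with h | h
  · exact (min_le_left _ _).trans h
  · exact (min_le_right _ _).trans (by linarith)

theorem foldRun_le_after_fold (hj : j ≤ K) (ht : 1 ≤ t) (h : t % 3 = 2 * j % 3) :
    foldRun K v t j ≤ 2 ^ (K - j) := by
  obtain ⟨t, rfl⟩ := Nat.exists_eq_add_of_le' ht
  rw [foldRun_succ, foldStep_fold h]
  exact min_sub_le_half (by rw [Nat.sub_add_comm hj, pow_succ'])

theorem foldRun_le_half_after_min (hj : j ≤ K) (ht : 1 ≤ t) (htj : K + 1 ≤ t + j)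
    (h : t % 3 = (2 * j + 1) % 3) : foldRun K v t j ≤ 1 / 2 := by
  induction hj using Nat.decreasingInduction generalizing t with
  | self =>
    obtain ⟨t, rfl⟩ := Nat.exists_eq_add_of_le' ht
    rw [foldRun_succ, foldStep_last h]
    exact min_sub_le_half (by norm_num)
  | of_succ j hj ih =>
    obtain ⟨t, rfl⟩ := Nat.exists_eq_add_of_le' ht
    rw [foldRun_succ, foldStep_min hj h]
    exact (min_le_right _ _).trans (ih (by omega) (by omega) (by omega))

theorem foldRun_le_after_max (hv : ∀ j ∈ Set.Icc 1 K, |v j| ≤ 2 ^ K) (hj : 1 ≤ j) (hjK : j ≤ K)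
    (htj : 2 * j ≤ t + 1) (h : t % 3 = (2 * j + 2) % 3) :
    foldRun K v t j ≤ 2 ^ (K + 1 - j) := by
  obtain rfl | hj1 := hj.eq_or_lt
  · exact (le_abs_self _).trans (abs_foldRun_le hv t 1 ⟨le_rfl, hjK⟩)
  · obtain ⟨j, rfl⟩ := Nat.exists_eq_add_of_le' hj
    obtain ⟨t, rfl⟩ : ∃ s, t = s + 2 := Nat.exists_eq_add_of_le' (by omega)
    have hlower : foldRun K v (t + 1) j ≤ 2 ^ (K - j) :=
      foldRun_le_after_fold (by omega) (by omega) (by omega)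
    have hupper : foldRun K v (t + 1) (j + 1) ≤ 2 ^ (K - j) :=
      calc foldRun K v (t + 1) (j + 1)
        _ ≤ foldRun K v t (j + 1) := foldStep_le_self_of_min hjK (by omega)
        _ ≤ 2 ^ (K - (j + 1)) := foldRun_le_after_fold hjK (by omega) (by omega)
        _ ≤ 2 ^ (K - j) := pow_le_pow_right₀ one_le_two (by omega)
    rw [foldRun_succ, foldStep_max (by omega) (by omega), Nat.add_sub_add_right]
    exact max_le hlower hupper

theorem foldRun_succ_nonneg_after_fold (hv : ∀ j ∈ Set.Icc 1 K, |v j| ≤ 2 ^ K) (hj : 1 ≤ j)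
    (hjK : j ≤ K) (htj : 2 * j ≤ t + 1) (h : (t + 1) % 3 = 2 * j % 3)
    (h0 : 0 ≤ foldRun K v t j) : 0 ≤ foldRun K v (t + 1) j := by
  rw [foldRun_succ, foldStep_fold h]
  exact le_min h0 (sub_nonneg.2 (foldRun_le_after_max hv hj hjK htj (by omega)))

theorem foldRun_nonneg_after_max (hv : ∀ j ∈ Set.Icc 1 K, |v j| ≤ 2 ^ K) (hj : 1 ≤ j)
    (hjK : j ≤ K) (htj : 2 * j ≤ t + 1) (h : t % 3 = (2 * j + 2) % 3) :
    0 ≤ foldRun K v t j := by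
  induction j, hj using Nat.le_induction generalizing t with
  | base =>
    obtain ⟨t, rfl⟩ : ∃ s, t = s + 1 := Nat.exists_eq_add_of_le' (by omega)
    rw [foldRun_succ, foldStep_first h]
    exact abs_nonneg _
  | succ j hj ih =>
    obtain ⟨t, rfl⟩ : ∃ s, t = s + 2 := Nat.exists_eq_add_of_le' (by omega)
    rw [foldRun_succ, foldStep_max hj (by omega)]
    exact le_max_of_le_left (foldRun_succ_nonneg_after_fold hv hj (by omega) (by omega) (by omega)
      (ih (by omega) (by omega) (by omega)))

theorem foldRun_nonneg_after_fold (hv : ∀ j ∈ Set.Icc 1 K, |v j| ≤ 2 ^ K) (hj : 1 ≤ j)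
    (hjK : j ≤ K) (htj : 2 * j ≤ t) (h : t % 3 = 2 * j % 3) : 0 ≤ foldRun K v t j := by
  obtain ⟨t, rfl⟩ : ∃ s, t = s + 1 := Nat.exists_eq_add_of_le' (by omega)
  exact foldRun_succ_nonneg_after_fold hv hj hjK htj h
    (foldRun_nonneg_after_max hv hj hjK htj (by omega))

theorem foldRun_nonneg_after_min (hv : ∀ j ∈ Set.Icc 1 K, |v j| ≤ 2 ^ K) (hj : 1 ≤ j)
    (hjK : j ≤ K) (htj : 3 * K + 1 ≤ t + j) (h : t % 3 = (2 * j + 1) % 3) :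
    0 ≤ foldRun K v t j := by
  induction hjK using Nat.decreasingInduction generalizing t with
  | self =>
    obtain ⟨t, rfl⟩ : ∃ s, t = s + 1 := Nat.exists_eq_add_of_le' (by omega)
    rw [foldRun_succ, foldStep_last h]
    have hle : foldRun K v t K ≤ 1 := by
      simpa using foldRun_le_after_fold (v := v) le_rfl (by omega) (by omega)
    exact le_min (foldRun_nonneg_after_fold hv hj le_rfl (by omega) (by omega)) (sub_nonneg.2 hle)
  | of_succ j hjK ih =>
    obtain ⟨t, rfl⟩ : ∃ s, t = s + 1 := Nat.exists_eq_add_of_le' (by omega)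
    rw [foldRun_succ, foldStep_min hjK h]
    exact le_min (foldRun_nonneg_after_fold hv hj (by omega) (by omega) (by omega))
      (ih (by omega) (by omega) (by omega))

theorem foldRun_succ_first_eq (hv : ∀ j ∈ Set.Icc 1 K, |v j| ≤ 2 ^ K) (hK : 1 ≤ K)
    (ht : 3 * K ≤ t) (h : t % 3 = 0) : foldRun K v (t + 1) 1 = foldRun K v t 1 := by
  rw [foldRun_succ, foldStep_first (by omega),
    abs_of_nonneg (foldRun_nonneg_after_min hv le_rfl hK (by omega) (by omega))]

theorem foldRun_le_half_after_max (hv : ∀ j ∈ Set.Icc 1 K, |v j| ≤ 2 ^ K) (hj : 1 ≤ j)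
    (hjK : j ≤ K) (htj : 3 * K + 2 * j ≤ t + 1) (h : t % 3 = (2 * j + 2) % 3) :
    foldRun K v t j ≤ 1 / 2 := by
  induction j, hj using Nat.le_induction generalizing t with
  | base =>
    obtain ⟨t, rfl⟩ : ∃ s, t = s + 1 := Nat.exists_eq_add_of_le' (by omega)
    rw [foldRun_succ_first_eq hv hjK (by omega) (by omega)]
    exact foldRun_le_half_after_min hjK (by omega) (by omega) (by omega)
  | succ j hj ih =>
    obtain ⟨t, rfl⟩ : ∃ s, t = s + 2 := Nat.exists_eq_add_of_le' (by omega)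
    have hlower : foldRun K v (t + 1) j ≤ 1 / 2 := by
      rw [foldRun_succ, foldStep_fold (by omega)]
      exact (min_le_left _ _).trans (ih (by omega) (by omega) (by omega))
    have hupper : foldRun K v (t + 1) (j + 1) ≤ 1 / 2 :=
      foldRun_le_half_after_min hjK (by omega) (by omega) (by omega)
    rw [foldRun_succ, foldStep_max hj (by omega)]
    exact max_le hlower hupper

theorem foldRun_succ_eq_of_fold (hv : ∀ j ∈ Set.Icc 1 K, |v j| ≤ 2 ^ K) (hj : 1 ≤ j)
    (hjK : j ≤ K) (htj : 3 * K + 2 * j ≤ t + 1) (h : (t + 1) % 3 = 2 * j % 3) :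
    foldRun K v (t + 1) j = foldRun K v t j := by
  have hhalf : foldRun K v t j ≤ 1 / 2 := foldRun_le_half_after_max hv hj hjK htj (by omega)
  have hpow : (1 : R) ≤ 2 ^ (K + 1 - j) := one_le_pow₀ one_le_two
  rw [foldRun_succ, foldStep_fold h, min_eq_left (by linarith)]

theorem foldRun_le_half_after_fold (hv : ∀ j ∈ Set.Icc 1 K, |v j| ≤ 2 ^ K) (hj : 1 ≤ j)
    (hjK : j ≤ K) (htj : 3 * K + 2 * j ≤ t) (h : t % 3 = 2 * j % 3) :
    foldRun K v t j ≤ 1 / 2 := by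
  obtain ⟨t, rfl⟩ : ∃ s, t = s + 1 := Nat.exists_eq_add_of_le' (by omega)
  rw [foldRun_succ_eq_of_fold hv hj hjK htj h]
  exact foldRun_le_half_after_max hv hj hjK htj (by omega)

theorem foldRun_le_succ_after_max (hv : ∀ j ∈ Set.Icc 1 K, |v j| ≤ 2 ^ K) (hj : 1 ≤ j)
    (hjK : j < K) (htj : 3 * K + 2 * j + 2 ≤ t) (h : t % 3 = (2 * j + 2) % 3) :
    foldRun K v t j ≤ foldRun K v t (j + 1) := by
  induction j, hj using Nat.le_induction generalizing t with
  | base =>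
    obtain ⟨t, rfl⟩ : ∃ s, t = s + 1 := Nat.exists_eq_add_of_le' (by omega)
    rw [foldRun_succ_first_eq hv (by omega) (by omega) (by omega),
      foldRun_succ_eq_of_fold (j := 1 + 1) hv (by omega) (by omega) (by omega) (by omega)]
    exact foldRun_le_succ_after_min le_rfl hjK (by omega) (by omega)
  | succ j hj ih =>
    obtain ⟨t, rfl⟩ : ∃ s, t = s + 2 := Nat.exists_eq_add_of_le' (by omega)
    have hlower : foldRun K v (t + 1) j ≤ foldRun K v (t + 1) (j + 1 + 1) := by
      rw [foldRun_succ_eq_of_fold hv hj (by omega) (by omega) (by omega)]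
      refine (ih (by omega) (by omega) (by omega)).trans ?_
      rw [foldRun_succ, foldStep_max (j := j + 1) (by omega) (by omega)]
      exact le_max_left _ _
    have hupper : foldRun K v (t + 1) (j + 1) ≤ foldRun K v (t + 1) (j + 1 + 1) :=
      foldRun_le_succ_after_min (by omega) hjK (by omega) (by omega)
    rw [foldRun_succ_eq_of_fold (t := t + 1) (j := j + 1 + 1) hv (by omega) (by omega) (by omega)
      (by omega), foldRun_succ (t := t + 1), foldStep_max hj (by omega)]
    exact max_le hlower hupper

theorem foldRun_succ_le_succ_after_fold (hv : ∀ j ∈ Set.Icc 1 K, |v j| ≤ 2 ^ K) (hj : 1 ≤ j)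
    (hjK : j < K) (htj : 3 * K + 2 * j + 2 ≤ t) (h : (t + 1) % 3 = 2 * j % 3)
    (heq : foldRun K v (t + 1) (j + 1) = foldRun K v t (j + 1)) :
    foldRun K v (t + 1) j ≤ foldRun K v (t + 1) (j + 1) := by
  rw [heq, foldRun_succ_eq_of_fold hv hj hjK.le (by omega) h]
  exact foldRun_le_succ_after_max hv hj hjK htj (by omega)

theorem foldRun_succ_eq_of_min (hv : ∀ j ∈ Set.Icc 1 K, |v j| ≤ 2 ^ K) (hj : 1 ≤ j)
    (hjK : j ≤ K) (htj : 6 * K ≤ t + j) (h : (t + 1) % 3 = (2 * j + 1) % 3) :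
    foldRun K v (t + 1) j = foldRun K v t j := by
  induction hjK using Nat.decreasingInduction generalizing t with
  | self =>
    have hhalf : foldRun K v t K ≤ 1 / 2 :=
      foldRun_le_half_after_fold hv hj le_rfl (by omega) (by omega)
    rw [foldRun_succ, foldStep_last h, min_eq_left (by linarith)]
  | of_succ j hjK ih =>
    obtain ⟨t, rfl⟩ : ∃ s, t = s + 1 := Nat.exists_eq_add_of_le' (by omega)
    rw [foldRun_succ, foldStep_min hjK h, min_eq_left]
    exact foldRun_succ_le_succ_after_fold hv hj hjK (by omega) (by omega)
      (ih (by omega) (by omega) (by omega))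

theorem foldRun_le_succ_after_fold (hv : ∀ j ∈ Set.Icc 1 K, |v j| ≤ 2 ^ K) (hj : 1 ≤ j)
    (hjK : j < K) (htj : 6 * K ≤ t + j) (h : t % 3 = 2 * j % 3) :
    foldRun K v t j ≤ foldRun K v t (j + 1) := by
  obtain ⟨t, rfl⟩ : ∃ s, t = s + 1 := Nat.exists_eq_add_of_le' (by omega)
  exact foldRun_succ_le_succ_after_fold hv hj hjK (by omega) h
    (foldRun_succ_eq_of_min hv (by omega) hjK (by omega) (by omega))

theorem monotoneOn_foldRun (hv : ∀ j ∈ Set.Icc 1 K, |v j| ≤ 2 ^ K) :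
    MonotoneOn (foldRun K v (6 * K - 3)) (Set.Icc 1 K) := by
  refine monotoneOn_of_le_add_one Set.ordConnected_Icc fun j _ ⟨hj, _⟩ ⟨_, hjK⟩ => ?_
  obtain h | h | h : j % 3 = 0 ∨ j % 3 = 1 ∨ j % 3 = 2 := by omega
  · exact foldRun_le_succ_after_fold hv hj hjK (by omega) (by omega)
  · exact foldRun_le_succ_after_min hj hjK (by omega) (by omega)
  · exact foldRun_le_succ_after_max hv hj hjK (by omega) (by omega)

theorem foldRun_first_nonneg (hv : ∀ j ∈ Set.Icc 1 K, |v j| ≤ 2 ^ K) (hK : 1 ≤ K) :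
    0 ≤ foldRun K v (6 * K - 3) 1 :=
  foldRun_nonneg_after_min hv le_rfl hK (by omega) (by omega)

theorem foldRun_last_le_half (hv : ∀ j ∈ Set.Icc 1 K, |v j| ≤ 2 ^ K) (hK : 1 ≤ K) :
    foldRun K v (6 * K - 3) K ≤ 1 / 2 := by
  obtain h | h | h : K % 3 = 0 ∨ K % 3 = 1 ∨ K % 3 = 2 := by omega
  · exact foldRun_le_half_after_fold hv hK le_rfl (by omega) (by omega)
  · exact foldRun_le_half_after_min le_rfl (by omega) (by omega) (by omega)
  · exact foldRun_le_half_after_max hv hK le_rfl (by omega) (by omega)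

end Fold

/-! ### The links of the network -/

section Link

variable {c c' δ K m q : ℕ}

/-- `Link K m c c' δ`: stage `m` of `P (K + 2)` links column `c` of the grid of registers, which
has `2 * K` columns, to column `c'`, `δ` rows further down. -/
inductive Link (K m c c' δ : ℕ) : Prop
  | long (hc : 1 ≤ c) (hcK : c ≤ K) (hm : m = 2 * c) (hc' : c' = 2 * K + 1 - c)
      (hδ : δ = 2 ^ (K + 1 - c) - 1)
  | left (hc : 1 ≤ c) (hcK : c ≤ K) (hm : m = 2 * c + 1) (hc' : c' = c + 1) (hδ : δ = 0)
  | right (hc : K < c) (hcK : c < 2 * K) (hm : m = 2 * (2 * K - c) + 1) (hc' : c' = c + 1)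
      (hδ : δ = 0)
  | wrap (hK : 1 ≤ K) (hm : m = 1) (hc : c = 2 * K) (hc' : c' = 1) (hδ : δ = 1)

/-- The links of stage `q` of the `3`-periodic network formed by passes of `M (K + 2)`. -/
def PeriodicLink (K q c c' δ : ℕ) : Prop :=
  ∃ m, m % 3 = q % 3 ∧ Link K m c c' δ

theorem PeriodicLink.congr {q' : ℕ} (h : q % 3 = q' % 3) :
    PeriodicLink K q = PeriodicLink K q' := by
  unfold PeriodicLink
  rw [h]

theorem Link.stage_bounds (h : Link K m c c' δ) : 1 ≤ m ∧ m ≤ 2 * K + 1 := by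
  cases h <;> omega

theorem Link.left_mem (h : Link K m c c' δ) : c ∈ Set.Icc 1 (2 * K) := by
  constructor <;> cases h <;> omega

theorem Link.right_mem (h : Link K m c c' δ) : c' ∈ Set.Icc 1 (2 * K) := by
  constructor <;> cases h <;> omega

theorem mod_three_cases (c q : ℕ) :
    2 * c % 3 = q % 3 ∨ (2 * c + 1) % 3 = q % 3 ∨ (2 * c + 2) % 3 = q % 3 := by
  have hc : c % 3 = 0 ∨ c % 3 = 1 ∨ c % 3 = 2 := by omega
  have hq : q % 3 = 0 ∨ q % 3 = 1 ∨ q % 3 = 2 := by omega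
  omega

theorem exists_periodicLink_of_le (hc : 1 ≤ c) (hcK : c ≤ K) :
    ∃ c' δ, PeriodicLink K q c c' δ ∨ PeriodicLink K q c' c δ := by
  obtain h | h | h := mod_three_cases c q
  · exact ⟨_, _, Or.inl ⟨_, h, .long hc hcK rfl rfl rfl⟩⟩
  · exact ⟨_, _, Or.inl ⟨_, h, .left hc hcK rfl rfl rfl⟩⟩
  · obtain rfl | h1 := hc.eq_or_lt
    · exact ⟨_, _, Or.inr ⟨1, by omega, .wrap hcK rfl rfl rfl rfl⟩⟩
    · exact ⟨c - 1, _, Or.inr ⟨2 * c - 1, by omega,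
        .left (by omega) (by omega) (by omega) (by omega) rfl⟩⟩

theorem exists_periodicLink_mirror (hc : 1 ≤ c) (hcK : c ≤ K) :
    ∃ c' δ, PeriodicLink K q (2 * K + 1 - c) c' δ ∨ PeriodicLink K q c' (2 * K + 1 - c) δ := by
  obtain h | h | h := mod_three_cases c q
  · exact ⟨_, _, Or.inr ⟨_, h, .long hc hcK rfl rfl rfl⟩⟩
  · obtain rfl | hlt := hcK.eq_or_lt
    · exact ⟨_, _, Or.inr ⟨_, h, .left hc le_rfl rfl (by omega) rfl⟩⟩
    · exact ⟨2 * K - c, _, Or.inr ⟨_, h,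
        .right (by omega) (by omega) (by omega) (by omega) rfl⟩⟩
  · obtain rfl | h1 := hc.eq_or_lt
    · exact ⟨_, _, Or.inl ⟨1, by omega, .wrap hcK rfl (by omega) rfl rfl⟩⟩
    · exact ⟨_, _, Or.inl ⟨2 * c - 1, by omega,
        .right (by omega) (by omega) (by omega) rfl rfl⟩⟩

theorem isColumnMatching_periodicLink (K q : ℕ) :
    IsColumnMatching (2 * K) (PeriodicLink K q) where
  left_mem := fun ⟨_, _, h⟩ => h.left_mem
  right_mem := fun ⟨_, _, h⟩ => h.right_mem
  left_unique := by
    rintro c c' d' δ ε ⟨m, hm, h⟩ ⟨m', hm', h'⟩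
    cases h <;> cases h' <;> omega
  right_unique := by
    rintro c d c' δ ε ⟨m, hm, h⟩ ⟨m', hm', h'⟩
    obtain rfl : c = d := by cases h <;> cases h' <;> omega
    cases h <;> cases h' <;> omega
  disjoint := by
    rintro c c' d δ ε ⟨m, hm, h⟩ ⟨m', hm', h'⟩
    cases h <;> cases h' <;> omega
  exists_link := by
    rintro c ⟨hc, hcK⟩
    obtain h | h := le_or_gt c K
    · exact exists_periodicLink_of_le hc h
    · obtain ⟨j, rfl⟩ : ∃ j, c = 2 * K + 1 - j := ⟨2 * K + 1 - c, by omega⟩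
      exact exists_periodicLink_mirror (by omega) (by omega)

end Link

section Level

variable {R : Type*} [Field R] {K c : ℕ} {s : R} {v w : ℕ → R}

/-- Column levels that add up to `2 * s` over each pair of opposite columns `c` and
`2 * K + 1 - c`. The shift by `1 / 2` makes them a sorted arrangement exactly if
`0 ≤ v 1 ≤ … ≤ v K ≤ 1 / 2`. -/
def level (K : ℕ) (s : R) (v : ℕ → R) (c : ℕ) : R :=
  if c ≤ K then s - 1 / 2 + v c else s + 1 / 2 - v (2 * K + 1 - c)

theorem level_of_le (hc : c ≤ K) : level K s v c = s - 1 / 2 + v c := if_pos hc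

theorem level_mirror (hcK : c ≤ K) :
    level K s v (2 * K + 1 - c) = s + 1 / 2 - v c := by
  rw [level, if_neg (by omega), Nat.sub_sub_self (by omega)]

theorem level_sub_add_half {C : ℕ → R} (hC : C c + C (2 * K + 1 - c) = 2 * s) :
    level K s (fun j => C j - s + 1 / 2) c = C c := by
  rw [level]
  split_ifs
  · ring
  · linear_combination -hC

variable [LinearOrder R] [IsStrictOrderedRing R]

theorem level_mirror_step {δ p : R} (hcK : c ≤ K) (hp : δ + 1 = p)
    (hw : w c = min (v c) (p - v c)) :
    level K s w c = min (level K s v c) (level K s v (2 * K + 1 - c) + δ) ∧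
      level K s w (2 * K + 1 - c) = max (level K s v (2 * K + 1 - c)) (level K s v c - δ) := by
  rw [level_of_le hcK, level_of_le hcK, level_mirror hcK, level_mirror hcK, hw,
    ← min_add_add_left, ← max_sub_sub_left]
  subst hp
  constructor <;> congr 1 <;> ring

theorem levelStep_foldStep (K q : ℕ) (s : R) (v : ℕ → R) :
    LevelStep (PeriodicLink K q) (level K s v) (level K s (foldStep K q v)) := by
  rintro c c' δ ⟨m, hmq, ⟨_, hcK, hm, rfl, rfl⟩ | ⟨hc, hcK, hm, rfl, rfl⟩ |
    ⟨_, hcK, hm, rfl, rfl⟩ | ⟨hK, hm, rfl, rfl, rfl⟩⟩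
  · refine level_mirror_step hcK ?_ (foldStep_fold (by omega))
    rw [Nat.cast_sub Nat.one_le_two_pow]
    simp
  · obtain rfl | hlt := hcK.eq_or_lt
    · rw [show c + 1 = 2 * c + 1 - c by omega]
      exact level_mirror_step le_rfl (by simp) (foldStep_last (by omega))
    · simp only [level_of_le hcK, level_of_le (Nat.succ_le_of_lt hlt),
        foldStep_min hlt (show q % 3 = (2 * c + 1) % 3 by omega),
        foldStep_max hc (show q % 3 = (2 * c + 1) % 3 by omega), Nat.cast_zero, add_zero, sub_zero]
      exact ⟨(min_add_add_left _ _ _).symm, by rw [max_add_add_left, max_comm]⟩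
  · obtain ⟨j, hj, rfl⟩ : ∃ j, j < K ∧ c = 2 * K + 1 - (j + 1) := ⟨2 * K - c, by omega, by omega⟩
    rw [show 2 * K + 1 - (j + 1) + 1 = 2 * K + 1 - j by omega]
    simp only [level_mirror hj.le, level_mirror (Nat.succ_le_of_lt hj),
      foldStep_min hj (show q % 3 = (2 * j + 1) % 3 by omega),
      foldStep_max (show 1 ≤ j by omega) (show q % 3 = (2 * j + 1) % 3 by omega),
      Nat.cast_zero, add_zero, sub_zero]
    exact ⟨by rw [min_sub_sub_left, max_comm], (max_sub_sub_left _ _ _).symm⟩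
  · rw [show 2 * K = 2 * K + 1 - 1 by omega, level_mirror hK, level_mirror hK,
      level_of_le hK, level_of_le hK, foldStep_first (by omega), abs, ← min_sub_sub_left,
      ← max_add_add_left, Nat.cast_one]
    constructor <;> congr 1 <;> ring

theorem monotoneOn_level (hw : MonotoneOn w (Set.Icc 1 K)) (hK : w K ≤ 1 / 2) :
    MonotoneOn (level K s w) (Set.Icc 1 (2 * K)) := by
  have hhalf : ∀ j, 1 ≤ j → j ≤ K → w j ≤ 1 / 2 := fun j hj hjK =>
    (hw ⟨hj, hjK⟩ ⟨hj.trans hjK, le_rfl⟩ hjK).trans hK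
  rintro c ⟨hc, hcK⟩ c' ⟨hc', hcK'⟩ hcc'
  rw [level, level]
  split_ifs with h h' h'
  · linarith [hw ⟨hc, h⟩ ⟨hc', h'⟩ hcc']
  · linarith [hhalf c hc h, hhalf (2 * K + 1 - c') (by omega) (by omega)]
  · omega
  · have hmirror : w (2 * K + 1 - c') ≤ w (2 * K + 1 - c) :=
      hw ⟨by omega, by omega⟩ ⟨by omega, by omega⟩ (by omega)
    linarith

theorem level_last_le (hK : 1 ≤ K) (hw : 0 ≤ w 1) : level K s w (2 * K) ≤ level K s w 1 + 1 := by
  rw [show 2 * K = 2 * K + 1 - 1 by omega, level_mirror hK, level_of_le hK]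
  linarith

end Level

/-! ### The network `M_k` -/

section Network

variable {K m m' q r x y : ℕ}

theorem n_add_two (K : ℕ) : n (K + 2) = 2 ^ (K + 1) - 1 := rfl

theorem b_add_two (K : ℕ) : b (K + 2) = 2 * K := rfl

theorem n_pos (K : ℕ) : 0 < n (K + 2) :=
  Nat.sub_pos_of_lt (Nat.one_lt_two_pow K.succ_ne_zero)

theorem isGridStage_firstStage (hK : 1 ≤ K) :
    IsGridStage (2 * K) (n (K + 2)) (Link K 1) (firstStage (K + 2)) := by
  intro x y
  simp only [firstStage, Finset.mem_image, Finset.mem_Icc, Prod.mk.injEq, b_add_two]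
  constructor
  · rintro ⟨i, ⟨hi, hin⟩, rfl, rfl⟩
    obtain ⟨i, rfl⟩ := Nat.exists_eq_add_of_le' hi
    exact ⟨i, _, _, _, .wrap hK rfl rfl rfl rfl, by omega, by ring, rfl⟩
  · rintro ⟨i, c, c', δ, h, hi, rfl, rfl⟩
    obtain ⟨rfl, rfl, rfl⟩ : c = 2 * K ∧ c' = 1 ∧ δ = 1 := by cases h <;> omega
    exact ⟨i + 1, by omega, by ring, rfl⟩

theorem isGridStage_longStage {j : ℕ} (hj : 1 ≤ j) (hjK : j ≤ K) :
    IsGridStage (2 * K) (n (K + 2)) (Link K (2 * j)) (longStage (K + 2) j) := by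
  intro x y
  have hexp : K + 2 - j - 1 = K + 1 - j := by omega
  have hpow : 1 ≤ 2 ^ (K + 1 - j) := Nat.one_le_two_pow
  have hpow' : 2 ^ (K + 1 - j) < 2 ^ (K + 1) := Nat.pow_lt_pow_right one_lt_two (by omega)
  simp only [longStage, Finset.mem_image, Finset.mem_Icc, Prod.mk.injEq, b_add_two, n_add_two,
    hexp, Nat.add_sub_assoc hpow, ← Nat.sub_add_comm (show j ≤ 2 * K by omega)]
  constructor
  · rintro ⟨i, hi, rfl, rfl⟩
    exact ⟨i, _, _, _, .long hj hjK rfl rfl rfl, by omega, rfl, rfl⟩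
  · rintro ⟨i, c, c', δ, h, hi, rfl, rfl⟩
    obtain ⟨rfl, rfl, rfl⟩ : c = j ∧ c' = 2 * K + 1 - j ∧ δ = 2 ^ (K + 1 - j) - 1 := by
      obtain rfl : c = j := by cases h <;> omega
      cases h <;> omega
    exact ⟨i, by omega, rfl, rfl⟩

theorem isGridStage_shortStage {j : ℕ} (hj : 1 ≤ j) (hjK : j ≤ K) :
    IsGridStage (2 * K) (n (K + 2)) (Link K (2 * j + 1)) (shortStage (K + 2) j) := by
  intro x y
  have hn := n_pos K
  simp only [shortStage, Finset.mem_union, Finset.mem_image, Finset.mem_Icc, Prod.mk.injEq,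
    b_add_two]
  constructor
  · rintro (⟨i, hi, rfl, rfl⟩ | ⟨i, hi, rfl, rfl⟩)
    · exact ⟨i, _, _, _, .left hj hjK rfl rfl rfl, by omega, rfl, rfl⟩
    · refine ⟨i, 2 * K - j, _, 0, ?_, by omega, rfl, rfl⟩
      obtain rfl | hlt := hjK.eq_or_lt
      · exact .left (by omega) (by omega) (by omega) rfl rfl
      · exact .right (by omega) (by omega) (by omega) rfl rfl
  · rintro ⟨i, c, c', δ, h, hi, rfl, rfl⟩
    obtain ⟨rfl | rfl, rfl, rfl⟩ : (c = j ∨ c = 2 * K - j) ∧ c' = c + 1 ∧ δ = 0 := by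
      cases h <;> omega
    · exact .inl ⟨i, by omega, rfl, rfl⟩
    · exact .inr ⟨i, by omega, rfl, rfl⟩

theorem depth_P (K : ℕ) : (P (K + 2)).depth = 2 * K + 1 := by
  simp only [P]
  omega

theorem mem_stage_P (hm : 1 ≤ m) (hmK : m ≤ 2 * K + 1) (hK : 1 ≤ K) :
    (x, y) ∈ (P (K + 2)).stage m ↔
      (m = 1 ∧ (x = 0 ∧ y = 1 ∨ x = 2 * K * n (K + 2) ∧ y = 2 * K * n (K + 2) + 1)) ∨
        ∃ i c c' δ, Link K m c c' δ ∧ i + δ < n (K + 2) ∧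
          x = 2 * K * i + c ∧ y = 2 * K * (i + δ) + c' := by
  simp only [P, b_add_two, mul_comm (n (K + 2))]
  obtain rfl | hm1 := eq_or_ne m 1
  · rw [if_pos rfl, Finset.mem_union, isGridStage_firstStage hK, or_comm]
    simp only [Finset.mem_insert, Finset.mem_singleton, Prod.mk.injEq, true_and]
  · simp only [hm1, if_false, false_and, false_or]
    obtain ⟨j, rfl | rfl⟩ := m.even_or_odd'
    · rw [if_pos (Nat.mul_mod_right 2 j), Nat.mul_div_cancel_left j two_pos,
        isGridStage_longStage (by omega) (by omega)]
    · rw [if_neg (by omega), show (2 * j + 1) / 2 = j by omega,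
        isGridStage_shortStage (by omega) (by omega)]

theorem Link.stage_mem_Icc_left {c c' δ : ℕ} (h : Link K m c c' δ) :
    m ∈ Set.Icc (2 * min c (2 * K + 1 - c) - 1) (2 * min c (2 * K + 1 - c) + 1) := by
  constructor <;> cases h <;> omega

theorem Link.stage_mem_Icc_right {c c' δ : ℕ} (h : Link K m c c' δ) :
    m ∈ Set.Icc (2 * min c' (2 * K + 1 - c') - 1) (2 * min c' (2 * K + 1 - c') + 1) := by
  constructor <;> cases h <;> omega

-- Rows are counted from `1` here, so that register `0` lies in column `2 * K` of row `0`.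
theorem exists_column_of_mem_regs_stage_P (hm : 1 ≤ m) (hmK : m ≤ 2 * K + 1) (hK : 1 ≤ K)
    (hr : r ∈ ((P (K + 2)).stage m).regs) :
    ∃ i, ∃ c ∈ Set.Icc 1 (2 * K), r + 2 * K = 2 * K * i + c ∧
      m ∈ Set.Icc (2 * min c (2 * K + 1 - c) - 1) (2 * min c (2 * K + 1 - c) + 1) := by
  have hfirst : 1 ∈ Set.Icc 1 (2 * K) := ⟨le_rfl, by omega⟩
  have hlast : 2 * K ∈ Set.Icc 1 (2 * K) := ⟨by omega, le_rfl⟩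
  simp only [Stage.mem_regs, mem_stage_P hm hmK hK] at hr
  obtain ⟨y, ⟨rfl, ⟨rfl, -⟩ | ⟨rfl, -⟩⟩ | ⟨i, c, c', δ, hl, -, rfl, -⟩⟩ |
    ⟨x, ⟨rfl, ⟨-, rfl⟩ | ⟨-, rfl⟩⟩ | ⟨i, c, c', δ, hl, -, -, rfl⟩⟩ := hr
  · exact ⟨0, _, hlast, by ring, by constructor <;> omega⟩
  · exact ⟨n (K + 2), _, hlast, by ring, by constructor <;> omega⟩
  · exact ⟨i + 1, c, hl.left_mem, by ring, hl.stage_mem_Icc_left⟩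
  · exact ⟨1, 1, hfirst, by ring, by constructor <;> omega⟩
  · exact ⟨n (K + 2) + 1, 1, hfirst, by ring, by constructor <;> omega⟩
  · exact ⟨i + δ + 1, c', hl.right_mem, by ring, hl.stage_mem_Icc_right⟩

theorem lt_add_three_of_mem_regs_stage_P (hm : 1 ≤ m) (hmK : m ≤ 2 * K + 1) (hm' : 1 ≤ m')
    (hmK' : m' ≤ 2 * K + 1) (hK : 1 ≤ K) (hr : r ∈ ((P (K + 2)).stage m).regs)
    (hr' : r ∈ ((P (K + 2)).stage m').regs) : m' < m + 3 := by
  obtain ⟨i, c, hc, heq, hge, -⟩ := exists_column_of_mem_regs_stage_P hm hmK hK hr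
  obtain ⟨i', c', hc', heq', -, hle⟩ := exists_column_of_mem_regs_stage_P hm' hmK' hK hr'
  obtain ⟨-, rfl⟩ := mul_add_inj hc hc' (heq.symm.trans heq')
  omega

theorem delay_P (hK : 1 ≤ K) : (P (K + 2)).delay = 3 := by
  have mem_usedAt : ∀ r m, m ∈ (P (K + 2)).usedAt r ↔
      (1 ≤ m ∧ m ≤ 2 * K + 1) ∧ r ∈ ((P (K + 2)).stage m).regs := fun r m => by
    rw [ComparatorNetwork.usedAt, Finset.mem_filter, Finset.mem_Icc, depth_P]
  refine (ComparatorNetwork.delay_le fun r i hi j hj => ?_).antisymm ?_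
  · obtain ⟨⟨hi1, hiK⟩, hri⟩ := (mem_usedAt r i).1 hi
    obtain ⟨⟨hj1, hjK⟩, hrj⟩ := (mem_usedAt r j).1 hj
    exact lt_add_three_of_mem_regs_stage_P hi1 hiK hj1 hjK hK hri hrj
  · have hn := n_pos K
    have used_first : 1 ∈ (P (K + 2)).usedAt 1 := by
      refine (mem_usedAt 1 1).2 ⟨by omega, Stage.mem_regs.2 (.inr ⟨0, ?_⟩)⟩
      exact (mem_stage_P le_rfl (by omega) hK).2 (.inl ⟨rfl, .inl ⟨rfl, rfl⟩⟩)
    have used_third : 3 ∈ (P (K + 2)).usedAt 1 := by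
      refine (mem_usedAt 1 3).2 ⟨by omega, Stage.mem_regs.2 (.inl ⟨2, ?_⟩)⟩
      exact (mem_stage_P (by omega) (by omega) hK).2
        (.inr ⟨0, 1, 2, 0, .left le_rfl hK rfl rfl rfl, hn, by ring, by ring⟩)
    have hreg : 1 ∈ (P (K + 2)).registers := Finset.mem_range.2 (by omega)
    have hlt := ComparatorNetwork.lt_add_delay hreg used_first used_third
    omega

theorem depth_M (hK : 1 ≤ K) : (M (K + 2)).depth = 3 := delay_P hK

theorem depth_passes_M (hK : 1 ≤ K) (t : ℕ) : ((M (K + 2)).passes t).depth = t * 3 :=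
  congrArg (t * ·) (depth_M hK)

theorem registers_M (K : ℕ) : (M (K + 2)).registers = Finset.Icc 1 (2 * K * n (K + 2)) := by
  ext r
  simp only [M, ComparatorNetwork.deleteRegisters, ComparatorNetwork.compactForm, P,
    Finset.mem_sdiff, Finset.mem_range, Finset.mem_insert, Finset.mem_singleton, Finset.mem_Icc,
    b_add_two, mul_comm (n (K + 2))]
  omega

theorem isGridStage_stage_M (hK : 1 ≤ K) (hq : 1 ≤ q) (hq3 : q ≤ 3) :
    IsGridStage (2 * K) (n (K + 2)) (PeriodicLink K q) ((M (K + 2)).stage q) := by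
  intro x y
  have mem_stage : (x, y) ∈ (M (K + 2)).stage q ↔
      (∃ m, 1 ≤ m ∧ m ≤ 2 * K + 1 ∧ m % 3 = q % 3 ∧ (x, y) ∈ (P (K + 2)).stage m) ∧
        ¬(x = 0 ∨ x = 2 * K * n (K + 2) + 1) ∧ ¬(y = 0 ∨ y = 2 * K * n (K + 2) + 1) := by
    simp only [M, ComparatorNetwork.deleteRegisters, Finset.mem_filter, b_add_two,
      mul_comm (n (K + 2)), Finset.mem_insert, Finset.mem_singleton]
    rw [ComparatorNetwork.mem_stage_compactForm hq (by rwa [delay_P hK])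
      (by rw [depth_P]; omega), depth_P, delay_P hK]
  rw [mem_stage]
  constructor
  · rintro ⟨⟨m, hm, hmK, hmq, hmem⟩, hx, hy⟩
    obtain ⟨-, h | h⟩ | ⟨i, c, c', δ, hl, hi, rfl, rfl⟩ := (mem_stage_P hm hmK hK).1 hmem
    · exact absurd (.inl h.1) hx
    · exact absurd (.inr h.2) hy
    · exact ⟨i, c, c', δ, ⟨m, hmq, hl⟩, hi, rfl, rfl⟩
  · rintro ⟨i, c, c', δ, ⟨m, hmq, hl⟩, hi, rfl, rfl⟩
    obtain ⟨hm, hmK⟩ := hl.stage_bounds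
    obtain ⟨hx, hxN⟩ := mul_add_mem_Icc (show i < n (K + 2) by omega) hl.left_mem
    obtain ⟨hy, hyN⟩ := mul_add_mem_Icc hi hl.right_mem
    exact ⟨⟨m, hm, hmK, hmq, (mem_stage_P hm hmK hK).2 (.inr ⟨i, c, c', δ, hl, hi, rfl, rfl⟩)⟩,
      by omega, by omega⟩

theorem isValid_M (hK : 1 ≤ K) : (M (K + 2)).IsValid := by
  intro q hq
  rw [depth_M hK, Finset.mem_Icc] at hq
  have hS := isGridStage_stage_M hK hq.1 hq.2
  have hL := isColumnMatching_periodicLink K q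
  exact ⟨hS.isValid hL, registers_M K ▸ hS.regs_subset hL⟩

theorem isGridStage_stage_passes_M (hK : 1 ≤ K) (t d : ℕ) :
    IsGridStage (2 * K) (n (K + 2)) (PeriodicLink K (d + 1))
      (((M (K + 2)).passes t).stage (d + 1)) := by
  have h := isGridStage_stage_M hK (q := d % 3 + 1) (by omega) (by omega)
  rwa [PeriodicLink.congr (show (d % 3 + 1) % 3 = (d + 1) % 3 by omega), ← depth_M hK] at h

end Network

/-! ### Merging -/

section Merge

variable {α : Type u} [LinearOrder α] {K N o e c : ℕ} {a : α} {x : ℕ → α}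

theorem exists_forall_le_iff_of_monotoneOn {y : ℕ → α} (hy : MonotoneOn y (Set.Iio N)) (a : α) :
    ∃ o ≤ N, ∀ m < N, a ≤ y m ↔ N ≤ m + o := by
  have hex : ∃ m, N ≤ m ∨ a ≤ y m := ⟨N, .inl le_rfl⟩
  classical
  have hle : Nat.find hex ≤ N := Nat.find_min' hex (.inl le_rfl)
  refine ⟨N - Nat.find hex, Nat.sub_le _ _, fun m hm => ⟨fun h => ?_, fun h => ?_⟩⟩
  · have hfind : Nat.find hex ≤ m := Nat.find_min' hex (.inr h)
    omega
  · have hfind : Nat.find hex ≤ m := by omega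
    obtain hN | ha := Nat.find_spec hex
    · omega
    · exact ha.trans (hy (hfind.trans_lt hm) hm hfind)

/-- The levels of the columns of a grid with `2 * K` columns if the last `o` odd and the last `e`
even registers contain large items. For even `c`, the numbers from `2 * e + c - 2` to
`2 * e + c - 1` would serve as numerators; this choice makes the sum over opposite columns
constant. -/
def initialLevel (K o e c : ℕ) : ℚ :=
  if Odd c then (2 * o + c - 1) / (2 * K) else (2 * e + c - 1) / (2 * K)

/-- Half the sum of the initial levels of two opposite columns. -/
def initialCenter (K o e : ℕ) : ℚ := (2 * (o + e) + 2 * K - 1) / (4 * K)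

theorem initialLevel_add_mirror (hc : c ≤ 2 * K) :
    initialLevel K o e c + initialLevel K o e (2 * K + 1 - c) = 2 * initialCenter K o e := by
  have hodd : Odd (2 * K + 1 - c) ↔ ¬ Odd c := by
    simp only [Nat.odd_iff]
    omega
  have hcast : ((2 * K + 1 - c : ℕ) : ℚ) = 2 * K + 1 - c := by
    push_cast [show c ≤ 2 * K + 1 by omega]
    ring
  by_cases h : Odd c <;>
    simp only [initialLevel, initialCenter, hodd, h, hcast, if_true, if_false, not_true,
      not_false_eq_true] <;> ring

theorem initialLevel_mem_Ico (ho : o ≤ K * N) (he : e ≤ K * N) (hc : c ∈ Set.Icc 1 (2 * K)) :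
    initialLevel K o e c ∈ Set.Ico 0 (N + 1 : ℚ) := by
  have hK : (0 : ℚ) < 2 * K := by exact_mod_cast hc.1.trans hc.2
  have hc1 : (1 : ℚ) ≤ c := by exact_mod_cast hc.1
  have hcK : (c : ℚ) ≤ 2 * K := by exact_mod_cast hc.2
  have bounds : ∀ p : ℕ, p ≤ K * N →
      ((2 * p + c - 1) / (2 * K) : ℚ) ∈ Set.Ico 0 (N + 1 : ℚ) := by
    intro p hp
    have hp' : (p : ℚ) ≤ K * N := by exact_mod_cast hp
    exact ⟨div_nonneg (by linarith [p.cast_nonneg (α := ℚ)]) hK.le,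
      (div_lt_iff₀ hK).2 (by linarith)⟩
  rw [initialLevel]
  split_ifs
  exacts [bounds o ho, bounds e he]

theorem abs_initialLevel_sub_initialCenter_add_half_le (ho : o ≤ K * N) (he : e ≤ K * N)
    (hc : c ∈ Set.Icc 1 K) :
    |initialLevel K o e c - initialCenter K o e + 1 / 2| ≤ (N + 1) / 2 := by
  have hK : (0 : ℚ) < K := by exact_mod_cast hc.1.trans hc.2
  have hc1 : (1 : ℚ) ≤ c := by exact_mod_cast hc.1
  have hcK : (c : ℚ) ≤ K := by exact_mod_cast hc.2
  have bound : ∀ p r : ℕ, p ≤ K * N → r ≤ K * N →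
      |((2 * p + c - 1) / (2 * K) - (2 * (p + r) + 2 * K - 1) / (4 * K) + 1 / 2 : ℚ)|
        ≤ (N + 1) / 2 := by
    intro p r hp hr
    have hp' : (p : ℚ) ≤ K * N := by exact_mod_cast hp
    have hr' : (r : ℚ) ≤ K * N := by exact_mod_cast hr
    have heq : (2 * p + c - 1) / (2 * K) - (2 * (p + r) + 2 * K - 1) / (4 * K) + 1 / 2 =
        ((2 * (p - r) + 2 * c - 1) / (4 * K) : ℚ) := by
      field_simp
      ring
    rw [heq, abs_le, le_div_iff₀ (by positivity), div_le_iff₀ (by positivity)]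
    constructor <;> linarith [p.cast_nonneg (α := ℚ), r.cast_nonneg (α := ℚ)]
  rw [initialLevel, initialCenter]
  split_ifs
  · exact bound o e ho he
  · rw [add_comm (o : ℚ)]
    exact bound e o he ho

theorem exists_hasLevels_initialLevel (a : α)
    (hodd : MonotoneOn x {r | r ∈ Finset.Icc 1 (2 * K * N) ∧ Odd r})
    (heven : MonotoneOn x {r | r ∈ Finset.Icc 1 (2 * K * N) ∧ Even r}) :
    ∃ o ≤ K * N, ∃ e ≤ K * N, HasLevels (2 * K) N a x (initialLevel K o e) := by
  have hassoc : 2 * K * N = 2 * (K * N) := mul_assoc 2 K N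
  obtain ⟨o, ho, hxo⟩ := exists_forall_le_iff_of_monotoneOn (y := fun m => x (2 * m + 1))
    (N := K * N) (fun m (hm : m < _) m' (hm' : m' < _) h => hodd
      ⟨Finset.mem_Icc.2 (by omega), by simp⟩ ⟨Finset.mem_Icc.2 (by omega), by simp⟩ (by omega)) a
  obtain ⟨e, he, hxe⟩ := exists_forall_le_iff_of_monotoneOn (y := fun m => x (2 * m + 2))
    (N := K * N) (fun m (hm : m < _) m' (hm' : m' < _) h => heven
      ⟨Finset.mem_Icc.2 (by omega), by simp [parity_simps]⟩
      ⟨Finset.mem_Icc.2 (by omega), by simp [parity_simps]⟩ (by omega)) a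
  refine ⟨o, ho, e, he, fun i hi c ⟨hc, hcK⟩ => ?_⟩
  have hrow : K * i + K ≤ K * N := Nat.mul_le_mul_left K hi
  have hK : (0 : ℚ) < 2 * K := by exact_mod_cast hc.trans hcK
  rw [initialLevel, ← sub_le_iff_le_add']
  split_ifs with h
  · obtain ⟨d, rfl⟩ := h
    rw [show 2 * K * i + (2 * d + 1) = 2 * (K * i + d) + 1 by ring, hxo _ (by omega),
      le_div_iff₀ hK, ← Nat.cast_le (α := ℚ)]
    push_cast
    constructor <;> intro h <;> linarith
  · obtain ⟨d, rfl⟩ : ∃ d, c = 2 * d + 2 := by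
      obtain ⟨d, rfl⟩ := Nat.not_odd_iff_even.1 h
      exact ⟨d - 1, by omega⟩
    have hround : K * N ≤ K * i + d + e ↔ 2 * (K * N) ≤ 2 * (K * i) + 2 * e + 2 * d + 1 := by
      omega
    rw [show 2 * K * i + (2 * d + 2) = 2 * (K * i + d) + 2 by ring, hxe _ (by omega),
      le_div_iff₀ hK, hround, ← Nat.cast_le (α := ℚ)]
    push_cast
    constructor <;> intro h <;> linarith

theorem exists_hasLevels_level (a : α)
    (hodd : MonotoneOn x {r | r ∈ Finset.Icc 1 (2 * K * N) ∧ Odd r})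
    (heven : MonotoneOn x {r | r ∈ Finset.Icc 1 (2 * K * N) ∧ Even r}) :
    ∃ (s : ℚ) (v : ℕ → ℚ), HasLevels (2 * K) N a x (level K s v) ∧
      (∀ c ∈ Set.Icc 1 (2 * K), level K s v c ∈ Set.Ico 0 (N + 1 : ℚ)) ∧
      ∀ j ∈ Set.Icc 1 K, |v j| ≤ (N + 1) / 2 := by
  obtain ⟨o, ho, e, he, hx⟩ := exists_hasLevels_initialLevel a hodd heven
  have level_eq : ∀ c ∈ Set.Icc 1 (2 * K), level K (initialCenter K o e)
      (fun j => initialLevel K o e j - initialCenter K o e + 1 / 2) c = initialLevel K o e c :=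
    fun c hc => level_sub_add_half (initialLevel_add_mirror hc.2)
  refine ⟨initialCenter K o e, _, fun i hi c hc => ?_, fun c hc => ?_, fun j hj =>
    abs_initialLevel_sub_initialCenter_add_half_le ho he hj⟩
  · rw [level_eq c hc]
    exact hx i hi c hc
  · rw [level_eq c hc]
    exact initialLevel_mem_Ico ho he hc

variable {A : ComparatorNetwork}

theorem hasLevels_runUpTo {s : ℚ} {v : ℕ → ℚ}
    (hA : ∀ d, IsGridStage (2 * K) N (PeriodicLink K (d + 1)) (A.stage (d + 1)))
    (hx : HasLevels (2 * K) N a x (level K s v))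
    (hv : ∀ c ∈ Set.Icc 1 (2 * K), level K s v c ∈ Set.Ico 0 (N + 1 : ℚ)) (d : ℕ) :
    HasLevels (2 * K) N a (A.runUpTo x d) (level K s (foldRun K v d)) := by
  have step := fun d => levelStep_foldStep K (d + 1) s (foldRun K v d)
  have matching := fun d => isColumnMatching_periodicLink K (d + 1)
  have hbound : ∀ d, ∀ c ∈ Set.Icc 1 (2 * K),
      level K s (foldRun K v d) c ∈ Set.Ico 0 (N + 1 : ℚ) := by
    intro d
    induction d with
    | zero => exact hv
    | succ d ih => exact (step d).mem_Ico (matching d) ih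
  induction d with
  | zero => exact hx
  | succ d ih => exact ih.apply (hA d) (matching d) (hbound d) (step d)

theorem monotoneOn_runUpTo (hK : 1 ≤ K) (hN : N < 2 ^ (K + 1))
    (hA : ∀ d, IsGridStage (2 * K) N (PeriodicLink K (d + 1)) (A.stage (d + 1)))
    (hodd : MonotoneOn x {r | r ∈ Finset.Icc 1 (2 * K * N) ∧ Odd r})
    (heven : MonotoneOn x {r | r ∈ Finset.Icc 1 (2 * K * N) ∧ Even r}) :
    MonotoneOn (A.runUpTo x (6 * K - 3)) (Set.Icc 1 (2 * K * N)) := by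
  refine monotoneOn_of_forall_exists_hasLevels (R := ℚ) fun a => ?_
  obtain ⟨s, v, hx, hlevel, hv⟩ := exists_hasLevels_level a hodd heven
  have hv' : ∀ j ∈ Set.Icc 1 K, |v j| ≤ 2 ^ K := fun j hj => by
    have hN' : (N + 1 : ℚ) ≤ 2 ^ K * 2 := by exact_mod_cast hN
    linarith [hv j hj]
  exact ⟨_, hasLevels_runUpTo hA hx hlevel _,
    monotoneOn_level (monotoneOn_foldRun hv') (foldRun_last_le_half hv' hK),
    level_last_le hK (foldRun_first_nonneg hv' hK)⟩

theorem mergesOddEven_passes_M (hK : 1 ≤ K) :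
    ((M (K + 2)).passes (2 * K - 1)).MergesOddEven.{u} := by
  intro α _ x hodd heven
  have hregs : ((M (K + 2)).passes (2 * K - 1)).registers = Finset.Icc 1 (2 * K * n (K + 2)) :=
    registers_M K
  have hdepth : ((M (K + 2)).passes (2 * K - 1)).depth = 6 * K - 3 := by
    rw [depth_passes_M hK]
    omega
  have hn : n (K + 2) < 2 ^ (K + 1) := Nat.sub_one_lt (pow_ne_zero _ two_ne_zero)
  refine ⟨?_, ComparatorNetwork.map_output ((isValid_M hK).passes _) x⟩
  rw [hregs] at hodd heven ⊢
  rw [ComparatorNetwork.output, hdepth]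
  exact (monotoneOn_runUpTo hK hn (isGridStage_stage_passes_M hK _) hodd heven).mono
    fun r hr => Finset.mem_Icc.1 hr

theorem sub_one_le_logb {k : ℕ} (hk : 3 ≤ k) :
    (k : ℝ) - 1 ≤ Real.logb 2 ((2 ^ k - 2) * (k - 2)) := by
  obtain ⟨m, rfl⟩ := Nat.exists_eq_add_of_le' (show 1 ≤ k by omega)
  have hpow : (2 : ℝ) ≤ 2 ^ m := le_self_pow₀ one_le_two (by omega)
  have hm : (2 : ℝ) ≤ m := by exact_mod_cast Nat.le_of_succ_le_succ hk
  have hle : (2 : ℝ) ^ m ≤ (2 ^ (m + 1) - 2) * (m - 1) := by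
    rw [pow_succ]
    nlinarith
  push_cast
  rw [add_sub_cancel_right, show (m : ℝ) + 1 - 2 = m - 1 by ring,
    Real.le_logb_iff_rpow_le one_lt_two (by linarith), Real.rpow_natCast]
  exact hle

end Merge

end PeriodicMerger

theorem theorem1 (k : ℕ) (hk : 3 ≤ k) :
    -- `M_k` is a comparator network with three stages on the registers `1, …, N_k`
    (PeriodicMerger.M k).IsValid ∧
    (PeriodicMerger.M k).depth = 3 ∧
    (PeriodicMerger.M k).registers = Finset.Icc 1 ((2 ^ k - 2) * (k - 2)) ∧
    -- applied repeatedly, it is a 3-periodic network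
    (∀ t : ℕ, 2 ≤ t → ((PeriodicMerger.M k).passes t).IsPeriodic 3) ∧
    -- `2k - 5` passes merge
    ((PeriodicMerger.M k).passes (2 * k - 5)).MergesOddEven.{u} ∧
    -- the running time
    (((PeriodicMerger.M k).passes (2 * k - 5)).depth : ℝ) = 6 * (k : ℝ) - 15 ∧
    6 * (k : ℝ) - 15 ≤ 6 * Real.logb 2 (((2 : ℝ) ^ k - 2) * ((k : ℝ) - 2)) := by
  obtain ⟨K, rfl⟩ : ∃ K, k = K + 2 := Nat.exists_eq_add_of_le' (by omega)
  have hK : 1 ≤ K := by omega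
  have hdepth := PeriodicMerger.depth_M hK
  rw [show 2 * (K + 2) - 5 = 2 * K - 1 by omega]
  refine ⟨PeriodicMerger.isValid_M hK, hdepth, ?_, fun t ht => ?_,
    PeriodicMerger.mergesOddEven_passes_M hK, ?_, ?_⟩
  · rw [PeriodicMerger.registers_M, PeriodicMerger.n_add_two, mul_right_comm, Nat.mul_sub,
      ← pow_succ', Nat.add_sub_cancel]
  · have hperiodic := ComparatorNetwork.isPeriodic_passes
      (hdepth.symm ▸ three_pos : 0 < (PeriodicMerger.M (K + 2)).depth) ht
    rwa [hdepth] at hperiodic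
  · rw [PeriodicMerger.depth_passes_M hK]
    push_cast [show 1 ≤ 2 * K by omega]
    ring
  · linarith [PeriodicMerger.sub_one_le_logb hk]
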